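/- All spaces are Hausdorff; a compactum is a compact Hausdorff space, and a condensation is a continuous bijection. A space is subcompact if it admits a condensation onto a compactum. For an infinite cardinal $\tau$, a space $X$ is almost $a_\tau$-subcompact if $X\setminus C$ is subcompact for every $C\subseteq X$ with $|C|\le\tau$; an $a_\tau$-space is a compact space $X$ such that $X\setminus C$ is subcompact for every $C\subseteq X$ with $|C|\le\tau$. Theorem. Let $\tau$ be an infinite cardinal, let $A$ be a set with $|A|=\tau$, let $Z$ be a compact Hausdorff space, let $X_\alpha$ ($\alpha\in A$) be Hausdorff spaces, and let $X=Z\oplus\bigl(\bigoplus_{\alpha\in A}X_\alpha\bigr)$ be the topological sum. (1) If every $X_\alpha$ is an $a_\tau$-space with $|X_\alpha|>\tau$, then $X$ is almost $a_\tau$-subcompact; that is, for every $C\subseteq X$ with $|C|\le\tau$ the space $X\setminus C$ admits a condensation onto a compactum. (2) If every $X_\alpha$ is a non-empty compact space, then for every $S\subseteq Z$ with $|S|\le\tau$ the space $X\setminus S$ is subcompact. -/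

import Mathlib

universe u v

open scoped Cardinal

/-- A condensation is a continuous bijection. -/
structure IsCondensation {X : Type u} {Y : Type v} [TopologicalSpace X] [TopologicalSpace Y]
    (f : X → Y) : Prop where
  continuous : Continuous f
  bijective : Function.Bijective f

/-- A space is subcompact if it admits a condensation onto a compactum (a compact Hausdorff
space). As a condensation is a bijection, it is no restriction to look for the compactum in
the universe of `X`. -/
def IsSubcompact (X : Type u) [TopologicalSpace X] : Prop :=
  ∃ (Y : Type u) (_ : TopologicalSpace Y),
    CompactSpace Y ∧ T2Space Y ∧ ∃ f : X → Y, IsCondensation f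

/-- `X` is almost `a_τ`-subcompact: the complement of every subset of cardinality at most `τ`
condenses onto a compactum. -/
def IsAlmostASubcompact (τ : Cardinal.{u}) (X : Type u) [TopologicalSpace X] : Prop :=
  ∀ C : Set X, #C ≤ τ → IsSubcompact (Cᶜ : Set X)

/-- `X` is an `a_τ`-space: a compact Hausdorff space such that the complement of every subset of
cardinality at most `τ` condenses onto a compactum. -/
structure IsASpace (τ : Cardinal.{u}) (X : Type u) [TopologicalSpace X] : Prop where
  compact : CompactSpace X
  t2 : T2Space X
  condenses : ∀ C : Set X, #C ≤ τ → IsSubcompact (Cᶜ : Set X)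

open Topology

/-! Up to homeomorphism, removing `C` leaves `Z \ S` and the remainders of the `X α`, which condense
onto non-empty compacta `Y α`. Only the holes `S` in `Z` remain to be filled. Since `S` has at most
as many points as `A`, distinct holes can be assigned distinct indices, and a point of the assigned
`Y α` fills each hole. Every other `Y α` receives an extra isolated point, which is identified with
a point of `Z`. Inside `Z × ∏ α, Y α` the glued space is closed, hence compact
(`IsSubcompact.of_pointed_compacta`). -/

theorem IsCondensation.comp {X Y W : Type*} [TopologicalSpace X] [TopologicalSpace Y]
    [TopologicalSpace W] {g : Y → W} {f : X → Y} (hg : IsCondensation g) (hf : IsCondensation f) :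
    IsCondensation (g ∘ f) :=
  ⟨hg.continuous.comp hf.continuous, hg.bijective.comp hf.bijective⟩

theorem Homeomorph.isCondensation {X Y : Type*} [TopologicalSpace X] [TopologicalSpace Y]
    (h : X ≃ₜ Y) : IsCondensation h :=
  ⟨h.continuous, h.bijective⟩

theorem IsSubcompact.of_condensation {X Y : Type u} [TopologicalSpace X] [TopologicalSpace Y]
    {f : X → Y} (hf : IsCondensation f) (hY : IsSubcompact Y) : IsSubcompact X := by
  obtain ⟨K, hK, hc, ht, g, hg⟩ := hY
  exact ⟨K, hK, hc, ht, g ∘ f, hg.comp hf⟩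

theorem IsSubcompact.of_isClosed_range {X K : Type u} [TopologicalSpace X] [TopologicalSpace K]
    [CompactSpace K] [T2Space K] {f : X → K} (hf : Continuous f) (hinj : Function.Injective f)
    (hcl : IsClosed (Set.range f)) : IsSubcompact X :=
  ⟨Set.range f, inferInstance, isCompact_iff_compactSpace.mp hcl.isCompact, inferInstance,
    Set.rangeFactorization f, hf.subtype_mk _,
    Set.rangeFactorization_injective.mpr hinj, Set.rangeFactorization_surjective⟩

/-- Glue compacta `Y α` to a compactum `Z` by identifying the base point `p α` with `φ α`. If
`X α` is mapped injectively into `Y α`, missing at most `p α`, and if the points of `S` are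
exactly the points of `Z` whose base points are covered, each once, then the result is a
condensation of the sum of `Z \ S` and of the `X α`. The glued space is realized as a closed
subspace of `Z × ∏ α, Y α`. -/
theorem IsSubcompact.of_pointed_compacta {Z A : Type u} {X Y : A → Type u} [TopologicalSpace Z]
    [CompactSpace Z] [T2Space Z] [∀ α, TopologicalSpace (X α)] [∀ α, TopologicalSpace (Y α)]
    [∀ α, CompactSpace (Y α)] [∀ α, T2Space (Y α)] (S : Set Z) (p : ∀ α, Y α) (φ : A → Z)
    (g : ∀ α, X α → Y α) (hg : ∀ α, Continuous (g α)) (hinj : ∀ α, Function.Injective (g α))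
    (hrange : ∀ α, {p α}ᶜ ⊆ Set.range (g α))
    (hφ : Set.BijOn φ {α | p α ∈ Set.range (g α)} S) :
    IsSubcompact ((Sᶜ : Set Z) ⊕ (Σ α, X α)) := by
  classical
  let F : (Sᶜ : Set Z) ⊕ (Σ α, X α) → Z × (∀ α, Y α) :=
    Sum.elim (fun z ↦ (z.1, p)) (fun x ↦ (φ x.1, Function.update p x.1 (g x.1 x.2)))
  have hF : Continuous F := by
    refine Continuous.sumElim (continuous_subtype_val.prodMk continuous_const)
      (continuous_sigma fun α ↦ ?_)
    exact (continuous_const (y := φ α)).prodMk ((continuous_const (y := p)).update α (hg α))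
  have hFinl : ∀ (z : (Sᶜ : Set Z)) (x : Σ α, X α), F (.inl z) ≠ F (.inr x) := by
    rintro ⟨z, hz⟩ ⟨α, x⟩ h
    obtain ⟨h₁, h₂⟩ := Prod.ext_iff.mp h
    have hp : p α = g α x := by simpa [F] using congrFun h₂ α
    have h₁ : z = φ α := h₁
    exact hz (h₁ ▸ hφ.mapsTo ⟨x, hp.symm⟩)
  have hFinj : Function.Injective F := by
    rintro (z | x) (w | y) h
    · exact congrArg _ (Subtype.ext (Prod.ext_iff.mp h).1)
    · exact (hFinl _ _ h).elim
    · exact (hFinl _ _ h.symm).elim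
    · obtain ⟨α, x⟩ := x
      obtain ⟨β, y⟩ := y
      obtain ⟨h₁, h₂⟩ := Prod.ext_iff.mp h
      have h₂ : Function.update p α (g α x) = Function.update p β (g β y) := h₂
      obtain rfl | hne := eq_or_ne α β
      · have := congrFun h₂ α
        simp only [Function.update_self] at this
        rw [hinj α this]
      -- Points of different pieces can agree only at their base points, and `φ` is injective on the
      -- covered ones.
      · have hα := congrFun h₂ α
        have hβ := congrFun h₂ β
        rw [Function.update_self, Function.update_of_ne hne] at hα
        rw [Function.update_self, Function.update_of_ne hne.symm] at hβ
        exact (hne (hφ.injOn ⟨x, hα⟩ ⟨y, hβ.symm⟩ h₁)).elim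
  -- At most one coordinate leaves its base point, and coordinate `α` only over `φ α`. Each
  -- condition is closed.
  have hFrange : Set.range F = {q | ∀ α, (q.2 α = p α ∨ q.1 = φ α) ∧
      ∀ β, α ≠ β → q.2 α = p α ∨ q.2 β = p β} := by
    ext q
    constructor
    · rintro ⟨z | ⟨γ, x⟩, rfl⟩ α
      · exact ⟨.inl rfl, fun _ _ ↦ .inl rfl⟩
      · refine ⟨?_, fun β hne ↦ ?_⟩
        · obtain rfl | h := eq_or_ne α γ
          · exact .inr rfl
          · exact .inl (Function.update_of_ne h _ _)
        · obtain rfl | h := eq_or_ne α γ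
          · exact .inr (Function.update_of_ne hne.symm _ _)
          · exact .inl (Function.update_of_ne h _ _)
    · intro hq
      by_cases hp : q.2 = p
      · by_cases hS : q.1 ∈ S
        · obtain ⟨α, ⟨x, hx⟩, hα⟩ := hφ.surjOn hS
          refine ⟨.inr ⟨α, x⟩, Prod.ext hα ?_⟩
          change Function.update p α (g α x) = q.2
          rw [hx, Function.update_eq_self, hp]
        · exact ⟨.inl ⟨q.1, hS⟩, Prod.ext rfl hp.symm⟩
      · obtain ⟨α, hα⟩ := Function.ne_iff.mp hp
        obtain ⟨x, hx⟩ := hrange α hα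
        refine ⟨.inr ⟨α, x⟩, Prod.ext ((hq α).1.resolve_left hα).symm ?_⟩
        refine Function.update_eq_iff.mpr ⟨hx, fun β hβ ↦ ?_⟩
        exact (((hq α).2 β hβ.symm).resolve_left hα).symm
  refine .of_isClosed_range hF hFinj ?_
  rw [hFrange]
  have hcoord (α : A) : IsClosed {q : Z × (∀ α, Y α) | q.2 α = p α} :=
    isClosed_eq (by fun_prop) continuous_const
  simp only [Set.ofPred_forall, Set.ofPred_and, Set.ofPred_or]
  refine isClosed_iInter fun α ↦ ((hcoord α).union
    (isClosed_eq continuous_fst continuous_const)).inter ?_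
  exact isClosed_iInter fun β ↦ isClosed_iInter fun _ ↦ (hcoord α).union (hcoord β)

theorem IsSubcompact.compl_sum_sigma_of_embedding {Z A : Type u} {X : A → Type u}
    [TopologicalSpace Z] [CompactSpace Z] [T2Space Z] [Nonempty Z] [∀ α, TopologicalSpace (X α)]
    [∀ α, CompactSpace (X α)] [∀ α, T2Space (X α)] [∀ α, Nonempty (X α)] (S : Set Z)
    (e : S ↪ A) : IsSubcompact ((Sᶜ : Set Z) ⊕ (Σ α, X α)) := by
  have key (α : A) : ∃ (Y : Type u) (_ : TopologicalSpace Y) (_ : CompactSpace Y)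
      (_ : T2Space Y) (p : Y) (g : X α → Y), Continuous g ∧ Function.Injective g ∧
        {p}ᶜ ⊆ Set.range g ∧ (p ∈ Set.range g ↔ α ∈ Set.range e) := by
    by_cases hα : α ∈ Set.range e
    · exact ⟨X α, inferInstance, inferInstance, inferInstance, Classical.arbitrary _, id,
        continuous_id, Function.injective_id, by simp, by simpa using hα⟩
    -- No hole is assigned to `α`, so the base point is a new isolated point that `X α` misses.
    · refine ⟨X α ⊕ PUnit.{u + 1}, inferInstance, inferInstance, inferInstance, .inr .unit, .inl,
        continuous_inl, Sum.inl_injective, ?_, by simpa using hα⟩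
      rintro (x | x) hx
      · exact ⟨x, rfl⟩
      · exact (hx rfl).elim
  choose Y tY cY hY p g hg hinj hrange hp using key
  -- Off the range of `e` the base point is not covered, so any attaching point will do, even one in
  -- `S`.
  refine .of_pointed_compacta S p (Function.extend e Subtype.val fun _ ↦ Classical.arbitrary Z) g
    hg hinj hrange ?_
  simp only [hp]
  refine ⟨?_, ?_, ?_⟩
  · rintro _ ⟨s, rfl⟩
    rw [e.injective.extend_apply]
    exact s.2
  · rintro _ ⟨s, rfl⟩ _ ⟨t, rfl⟩ h
    rw [e.injective.extend_apply, e.injective.extend_apply] at h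
    rw [Subtype.ext h]
  · intro s hs
    exact ⟨e ⟨s, hs⟩, ⟨_, rfl⟩, e.injective.extend_apply _ _ _⟩

theorem IsSubcompact.compl_sum_sigma {Z A : Type u} {X : A → Type u}
    [TopologicalSpace Z] [CompactSpace Z] [T2Space Z] [Nonempty A] [∀ α, TopologicalSpace (X α)]
    [∀ α, CompactSpace (X α)] [∀ α, T2Space (X α)] [∀ α, Nonempty (X α)] (S : Set Z)
    (hS : #S ≤ #A) : IsSubcompact ((Sᶜ : Set Z) ⊕ (Σ α, X α)) := by
  classical
  obtain hZ | hZ := isEmpty_or_nonempty Z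
  -- An empty `Z` has no attaching points. The summand `X α₀` takes its place, with no holes.
  · let α₀ : A := Classical.arbitrary A
    let X' : {α // α ≠ α₀} → Type u := fun α ↦ X α
    have hsub : IsSubcompact (((∅ : Set (X α₀))ᶜ : Set (X α₀)) ⊕ (Σ α, X' α)) :=
      .compl_sum_sigma_of_embedding ∅ ⟨fun s ↦ s.2.elim, fun s ↦ s.2.elim⟩
    let f : (Sᶜ : Set Z) ⊕ (Σ α, X α) → ((∅ : Set (X α₀))ᶜ : Set (X α₀)) ⊕ (Σ α, X' α) :=
      Sum.elim (fun z ↦ isEmptyElim z.1) fun x ↦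
        if h : x.1 = α₀ then .inl ⟨h ▸ x.2, id⟩ else .inr ⟨⟨x.1, h⟩, x.2⟩
    have hf₀ (x : X α₀) : f (.inr ⟨α₀, x⟩) = .inl ⟨x, id⟩ := dif_pos rfl
    have hf₁ (α : A) (h : α ≠ α₀) (x : X α) : f (.inr ⟨α, x⟩) = .inr ⟨⟨α, h⟩, x⟩ := dif_neg h
    refine .of_condensation (f := f) ⟨?_, ?_, ?_⟩ hsub
    · refine continuous_sum_dom.mpr ⟨continuous_of_const fun z ↦ isEmptyElim z.1,
        continuous_sigma fun α ↦ ?_⟩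
      by_cases h : α = α₀
      · subst h
        exact (continuous_inl.comp (continuous_id.subtype_mk _)).congr fun x ↦ (hf₀ x).symm
      · exact (continuous_inr.comp (continuous_sigmaMk (σ := X') (i := ⟨α, h⟩))).congr
          fun x ↦ (hf₁ α h x).symm
    · rintro (z | ⟨α, x⟩) (w | ⟨β, y⟩) hxy
      · exact isEmptyElim z.1
      · exact isEmptyElim z.1
      · exact isEmptyElim w.1
      · by_cases hα : α = α₀ <;> by_cases hβ : β = α₀
        · subst hα
          subst hβ
          rw [hf₀, hf₀] at hxy
          simpa using hxy
        · subst hα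
          rw [hf₀, hf₁ β hβ] at hxy
          cases hxy
        · subst hβ
          rw [hf₀, hf₁ α hα] at hxy
          cases hxy
        · rw [hf₁ α hα, hf₁ β hβ] at hxy
          cases hxy
          rfl
    · rintro (⟨x, hx⟩ | ⟨⟨α, h⟩, x⟩)
      · exact ⟨_, hf₀ x⟩
      · exact ⟨_, hf₁ α h x⟩
  · obtain ⟨e⟩ := hS
    exact .compl_sum_sigma_of_embedding S e

theorem IsCondensation.sumMap_sigmaMap {W A : Type*} {X Y : A → Type*} [TopologicalSpace W]
    [∀ α, TopologicalSpace (X α)] [∀ α, TopologicalSpace (Y α)] {f : ∀ α, X α → Y α}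
    (hf : ∀ α, IsCondensation (f α)) :
    IsCondensation (Sum.map (id : W → W) (Sigma.map id f)) where
  continuous := continuous_id.sumMap (Continuous.sigma_map fun α ↦ (hf α).continuous)
  bijective := Sum.map_bijective.mpr ⟨Function.bijective_id,
    Function.injective_id.sigma_map fun α ↦ (hf α).bijective.1,
    Function.surjective_id.sigma_map fun α ↦ (hf α).bijective.2⟩

theorem exists_isCondensation_subtype_sum_sigma {Z A : Type*} {X : A → Type*} [TopologicalSpace Z]
    [∀ α, TopologicalSpace (X α)] (D : Set (Z ⊕ (Σ α, X α))) :
    ∃ f : D → (Sum.inl ⁻¹' D : Set Z) ⊕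
      (Σ α, ((fun x : X α ↦ (Sum.inr ⟨α, x⟩ : Z ⊕ (Σ α, X α))) ⁻¹' D : Set (X α))),
      IsCondensation f := by
  let i (α : A) (x : X α) : Z ⊕ (Σ α, X α) := .inr ⟨α, x⟩
  have hi (α : A) : IsOpenEmbedding (i α) := IsOpenEmbedding.inr.comp .sigmaMk
  let H : (Sum.inl ⁻¹' D : Set Z) ⊕ (Σ α, (i α ⁻¹' D : Set (X α))) → D :=
    Sum.elim (D.restrictPreimage Sum.inl) fun x ↦ D.restrictPreimage (i x.1) x.2
  have hH : IsHomeomorph H := by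
    refine ⟨?_, ?_, ?_, ?_⟩
    · exact continuous_inl.restrictPreimage.sumElim
        (continuous_sigma fun α ↦ (hi α).continuous.restrictPreimage)
    · refine isOpenMap_sum.mpr ⟨isOpenMap_inl.restrictPreimage D, isOpenMap_sigma.mpr fun α ↦ ?_⟩
      exact (hi α).isOpenMap.restrictPreimage D
    · rintro (⟨z, hz⟩ | ⟨α, x, hx⟩) (⟨w, hw⟩ | ⟨β, y, hy⟩) h <;> cases Subtype.ext_iff.mp h <;> rfl
    · rintro ⟨z | ⟨α, x⟩, h⟩
      · exact ⟨.inl ⟨z, h⟩, rfl⟩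
      · exact ⟨.inr ⟨α, x, h⟩, rfl⟩
  exact ⟨_, hH.homeomorph.symm.isCondensation⟩

theorem IsSubcompact.compl_of_summands {Z A : Type u} {X : A → Type u} [TopologicalSpace Z]
    [CompactSpace Z] [T2Space Z] [Nonempty A] [∀ α, TopologicalSpace (X α)]
    (C : Set (Z ⊕ (Σ α, X α))) (hC : #(Sum.inl ⁻¹' C : Set Z) ≤ #A)
    (hne : ∀ α, ((fun x : X α ↦ (Sum.inr ⟨α, x⟩ : Z ⊕ (Σ α, X α))) ⁻¹' C)ᶜ.Nonempty)
    (hX : ∀ α, IsSubcompact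
      (((fun x : X α ↦ (Sum.inr ⟨α, x⟩ : Z ⊕ (Σ α, X α))) ⁻¹' C)ᶜ : Set (X α))) :
    IsSubcompact (Cᶜ : Set (Z ⊕ (Σ α, X α))) := by
  choose Y tY cY hY f hf using hX
  have hYne (α : A) : Nonempty (Y α) := (hne α).to_subtype.map (f α)
  obtain ⟨h, hh⟩ := exists_isCondensation_subtype_sum_sigma Cᶜ
  exact .of_condensation ((IsCondensation.sumMap_sigmaMap hf).comp hh)
    (.compl_sum_sigma (Sum.inl ⁻¹' C) hC)

theorem theorem2p4 (τ : Cardinal.{u}) (hτ : ℵ₀ ≤ τ)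
    (Z : Type u) [TopologicalSpace Z] [CompactSpace Z] [T2Space Z]
    (A : Type u) (hA : #A = τ)
    (X : A → Type u) [∀ α, TopologicalSpace (X α)] :
    ((∀ α, IsASpace τ (X α)) → (∀ α, τ < #(X α)) →
        IsAlmostASubcompact τ (Z ⊕ (Σ α, X α))) ∧
    ((∀ α, Nonempty (X α)) → (∀ α, CompactSpace (X α)) → (∀ α, T2Space (X α)) →
        ∀ S : Set Z, #S ≤ τ →
          IsSubcompact ((Sum.inl '' S)ᶜ : Set (Z ⊕ (Σ α, X α)))) := by
  have : Nonempty A := Cardinal.mk_ne_zero_iff.mp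
    (hA ▸ (Cardinal.aleph0_pos.trans_le hτ).ne')
  refine ⟨fun hX hcard C hC ↦ ?_, fun hne hc ht S hS ↦ ?_⟩
  · have hle (α : A) : #((fun x : X α ↦ (Sum.inr ⟨α, x⟩ : Z ⊕ (Σ α, X α))) ⁻¹' C : Set (X α)) ≤ τ :=
      (Cardinal.mk_preimage_of_injective _ _
        (Sum.inr_injective.comp sigma_mk_injective)).trans hC
    refine .compl_of_summands C ?_ (fun α ↦ ?_) fun α ↦ (hX α).condenses _ (hle α)
    · exact hA ▸ (Cardinal.mk_preimage_of_injective _ _ Sum.inl_injective).trans hC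
    -- The bound `τ < #(X α)` serves only to keep a point of `X α` outside `C`, so that the
    -- compactum can supply a base point.
    · refine Set.nonempty_compl.mpr fun h ↦ ?_
      have := hle α
      rw [h, Cardinal.mk_univ] at this
      exact this.not_gt (hcard α)
  · have hempty (α : A) : ((fun x : X α ↦ (Sum.inr ⟨α, x⟩ : Z ⊕ (Σ α, X α))) ⁻¹'
        (Sum.inl '' S))ᶜ = Set.univ := by
      ext x
      simp
    refine .compl_of_summands _ ?_ (fun α ↦ ?_) fun α ↦ ?_
    · rw [Set.preimage_image_eq _ Sum.inl_injective]
      exact hS.trans_eq hA.symm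
    · rw [hempty]
      exact Set.univ_nonempty
    · rw [hempty]
      exact ⟨X α, inferInstance, hc α, ht α, _, (Homeomorph.Set.univ (X α)).isCondensation⟩
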